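/- **Model.** A GPU is shared by a set of tasks (processes), each owning one time-sliced group (TSG) of GPU commands. A job of task $\tau_i$ has $\eta^g_i$ GPU segments; during the $j$-th one it submits at most $G^e_{i,j}$ units of GPU work. A task is *real-time* if its real-time priority is positive and *best-effort* otherwise; GPU priorities are positive for real-time tasks and $0$ for best-effort tasks. The GPU serves the TSGs on the *runlist* round-robin, in time slices of length $L$, skipping TSGs without commands; moving from one TSG to another costs at most $\theta$. The runlist consists of one entry for every task in a set $\mathit{running}$ that the driver maintains together with a set $\mathit{pending}$; both are empty initially. Each update of the runlist takes at most $\epsilon=\alpha+\theta$. Under GCAPS the driver updates the sets as follows. - When a GPU segment of a best-effort task begins, the task is added to $\mathit{running}$ if that set contains no real-time task, and to $\mathit{pending}$ otherwise. - When a GPU segment of a real-time task $\tau_i$ begins: if $\tau_i$ has higher GPU priority than the highest-priority task(s) in $\mathit{running}$ (or $\mathit{running}$ is empty), then $\tau_i$ is added to $\mathit{running}$ and all those highest-priority tasks are moved to $\mathit{pending}$; otherwise $\tau_i$ is added to $\mathit{pending}$. - A GPU segment of $\tau_i$ ends when its submitted commands have been executed and $\tau_i\in\mathit{running}$. Then $\tau_i$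 is removed from $\mathit{running}$, and a highest-priority real-time task in $\mathit{pending}$ is moved to $\mathit{running}$; if there is no real-time task in $\mathit{pending}$, all tasks in $\mathit{pending}$ are moved to $\mathit{running}$. The *interleaved-execution interference* $I^{ie}_i$ of $\tau_i$ is the supremum, over all executions of the system (with arbitrary behaviour of the tasks on the CPU side) and over all jobs of $\tau_i$ in them, of the total time during the job in which the TSG of $\tau_i$ is on the runlist and has commands to execute, but the GPU executes another TSG of the runlist or is switching from one TSG of the runlist to another in the course of its round-robin service (time spent on runlist updates is not counted). **Lemma (interleaved execution, proposed approach).** Under GCAPS, for every real-time task $\tau_i$: whenever the TSG of $\tau_i$ is on the runlist, it is the only entry of the runlist; and $I^{ie}_i=0$. -/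

import Mathlib

namespace GCAPS

/-- A platform with one GPU together with a set of tasks (processes), each owning one TSG. -/
structure System (Task : Type*) where
  /-- OS-level priority; `0` means that no real-time priority is set (best-effort task). -/
  rtPrio : Task → ℕ
  /-- Priority of the GPU segments of a task (by default it equals `rtPrio`). -/
  gpuPrio : Task → ℕ
  /-- Best-effort tasks share the lowest GPU priority `0`, real-time tasks are above it. -/
  gpuPrio_pos_iff : ∀ i, 0 < gpuPrio i ↔ 0 < rtPrio i
  /-- Number of GPU segments in each job of a task. -/
  numSeg : Task → ℕ
  /-- WCET of the pure GPU part of each GPU segment of a job. -/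
  pureGpu : (i : Task) → Fin (numSeg i) → ℝ
  pureGpu_nonneg : ∀ i j, 0 ≤ pureGpu i j
  /-- Length of a TSG time slice. -/
  slice : ℝ
  slice_pos : 0 < slice
  /-- GPU context switch overhead. -/
  theta : ℝ
  theta_nonneg : 0 ≤ theta
  /-- Cost of one run of the TSG scheduler in the driver. -/
  alpha : ℝ
  alpha_nonneg : 0 ≤ alpha

namespace System

variable {Task : Type*} (S : System Task)

/-- A task is real-time if its real-time priority is set. -/
def IsRealTime (i : Task) : Prop := 0 < S.rtPrio i

instance (i : Task) : Decidable (S.IsRealTime i) :=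
  inferInstanceAs (Decidable (0 < S.rtPrio i))

/-- Runlist update delay. -/
def epsilon : ℝ := S.alpha + S.theta

/-- The tasks of highest GPU priority in a set of tasks (empty for the empty set). -/
def highest (A : Finset Task) : Finset Task :=
  A.filter fun h => ∀ h' ∈ A, S.gpuPrio h' ≤ S.gpuPrio h

end System

/-- The two task lists kept by the driver. -/
structure DriverState (Task : Type*) where
  running : Finset Task
  pending : Finset Task

/-- Requests to the driver: a GPU segment of the task begins, or has been completed. -/
inductive Request (Task : Type*)
  | segBegin (i : Task)
  | segEnd (i : Task)

/-- A driver policy relates the old lists, a request, and the possible new lists. -/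
abbrev Driver (Task : Type*) := DriverState Task → Request Task → DriverState Task → Prop

section Policy

variable {Task : Type*} [DecidableEq Task]

/-- The GCAPS policy. The only freedom is the choice among pending tasks of equal priority. -/
inductive gcaps (S : System Task) : Driver Task
  /-- A best-effort task begins, and no real-time task is running. -/
  | addBestEffortRunning (s : DriverState Task) (i : Task)
      (hi : ¬ S.IsRealTime i) (hr : ∀ h ∈ s.running, ¬ S.IsRealTime h) :
      gcaps S s (.segBegin i) ⟨insert i s.running, s.pending⟩
  /-- A best-effort task begins while a real-time task is running. -/
  | addBestEffortPending (s : DriverState Task) (i : Task)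
      (hi : ¬ S.IsRealTime i) (hr : ∃ h ∈ s.running, S.IsRealTime h) :
      gcaps S s (.segBegin i) ⟨s.running, insert i s.pending⟩
  /-- A real-time task begins and has higher priority than the highest-priority running
  task(s), which are preempted; this includes the case that nothing is running. -/
  | addRealTimeRunning (s : DriverState Task) (i : Task)
      (hi : S.IsRealTime i) (hr : ∀ h ∈ S.highest s.running, S.gpuPrio h < S.gpuPrio i) :
      gcaps S s (.segBegin i)
        ⟨insert i (s.running \ S.highest s.running), s.pending ∪ S.highest s.running⟩
  /-- A real-time task begins and does not have higher priority than the running one. -/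
  | addRealTimePending (s : DriverState Task) (i : Task)
      (hi : S.IsRealTime i) (hr : ∃ h ∈ S.highest s.running, S.gpuPrio i ≤ S.gpuPrio h) :
      gcaps S s (.segBegin i) ⟨s.running, insert i s.pending⟩
  /-- A segment ends, and `k` is the highest-priority pending real-time task. -/
  | removeNextRealTime (s : DriverState Task) (i k : Task)
      (hk : k ∈ S.highest (s.pending.filter fun j => S.IsRealTime j)) :
      gcaps S s (.segEnd i) ⟨(insert k s.running).erase i, s.pending.erase k⟩
  /-- A segment ends, and no real-time task is pending: all remaining tasks share the GPU. -/
  | removeNoRealTime (s : DriverState Task) (i : Task)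
      (hp : ∀ k ∈ s.pending, ¬ S.IsRealTime k) :
      gcaps S s (.segEnd i) ⟨s.running.erase i ∪ s.pending, ∅⟩

end Policy

/-- Progress of a task: no job, or a job that has completed `j` GPU segments and is now
outside a GPU segment (`cpu j`) or inside the next one (`gpu j`). -/
inductive Phase
  | noJob
  | cpu (j : ℕ)
  | gpu (j : ℕ)

/-- State of the driver, of the GPU and of all tasks. -/
structure State (Task : Type*) where
  drv : DriverState Task
  /-- The runlist held by the hardware, rotated so that its head is the current TSG. -/
  runlist : List Task
  /-- The part of the current time slice that is used up. -/
  used : ℝ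
  phase : Task → Phase
  /-- GPU work that the current GPU segment of a task may still submit. -/
  budget : Task → ℝ
  /-- GPU work that a task has submitted to its TSG and that has not been executed. -/
  backlog : Task → ℝ

/-- What happens in one step. -/
inductive Activity (Task : Type*)
  /-- a job of `i` starts -/
  | jobStart (i : Task)
  /-- a job of `i` is completed -/
  | jobEnd (i : Task)
  /-- `i` submits GPU commands to its TSG -/
  | submit (i : Task)
  /-- the driver handles a request and replaces the runlist -/
  | update (r : Request Task)
  /-- the GPU executes commands of the TSG of `i` -/
  | exec (i : Task)
  /-- the GPU moves from the TSG of `i` to that of `j` within the runlist -/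
  | switch (i j : Task)
  /-- the only active TSG on the runlist gets a new time slice -/
  | renew
  /-- no TSG on the runlist has commands to execute -/
  | idle

section Semantics

variable {Task : Type*} [DecidableEq Task]

/-- `l` is a runlist that has exactly one entry for every running task, in any order. -/
def IsRunlistOf (l : List Task) (d : DriverState Task) : Prop :=
  l.Nodup ∧ ∀ i, i ∈ l ↔ i ∈ d.running

/-- `Step S drv s a d s'`: under the driver policy `drv` the activity `a`, of duration `d`, leads
from `s` to `s'`. The TSGs on the runlist are served round-robin in time slices. Everything on
the CPU side (arrivals, CPU scheduling, busy-waiting or self-suspension) is unconstrained. -/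
inductive Step (S : System Task) (drv : Driver Task) :
    State Task → Activity Task → ℝ → State Task → Prop
  | jobStart (s : State Task) (i : Task) (hp : s.phase i = .noJob) :
      Step S drv s (.jobStart i) 0 { s with phase := Function.update s.phase i (.cpu 0) }
  | jobEnd (s : State Task) (i : Task) (hp : s.phase i = .cpu (S.numSeg i)) :
      Step S drv s (.jobEnd i) 0 { s with phase := Function.update s.phase i .noJob }
  | submit (s : State Task) (i : Task) (j : ℕ) (w : ℝ) (hp : s.phase i = .gpu j)
      (hw : 0 < w) (hb : w ≤ s.budget i) :
      Step S drv s (.submit i) 0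
        { s with
          budget := Function.update s.budget i (s.budget i - w)
          backlog := Function.update s.backlog i (s.backlog i + w) }
  | segBegin (s : State Task) (i : Task) (j : Fin (S.numSeg i)) (d' : DriverState Task)
      (l : List Task) (d : ℝ) (hp : s.phase i = .cpu j)
      (hd : drv s.drv (.segBegin i) d') (hl : IsRunlistOf l d') (h0 : 0 ≤ d)
      (h1 : d ≤ S.epsilon) :
      Step S drv s (.update (.segBegin i)) d
        { s with
          drv := d'
          runlist := l
          used := 0
          phase := Function.update s.phase i (.gpu j)
          budget := Function.update s.budget i (S.pureGpu i j) }
  /-- A segment is completed when its commands have been executed; its task is on the list of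
  running tasks, from which it is to be removed. -/
  | segEnd (s : State Task) (i : Task) (j : ℕ) (d' : DriverState Task)
      (l : List Task) (d : ℝ) (hp : s.phase i = .gpu j) (hb : s.backlog i = 0)
      (hr : i ∈ s.drv.running) (hd : drv s.drv (.segEnd i) d') (hl : IsRunlistOf l d')
      (h0 : 0 ≤ d) (h1 : d ≤ S.epsilon) :
      Step S drv s (.update (.segEnd i)) d
        { s with
          drv := d'
          runlist := l
          used := 0
          phase := Function.update s.phase i (.cpu (j + 1))
          budget := Function.update s.budget i 0 }
  | exec (s : State Task) (i : Task) (t : List Task) (d : ℝ) (hl : s.runlist = i :: t)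
      (h0 : 0 < d) (hb : d ≤ s.backlog i) (hu : s.used + d ≤ S.slice) :
      Step S drv s (.exec i) d
        { s with
          used := s.used + d
          backlog := Function.update s.backlog i (s.backlog i - d) }
  /-- The slice of `i` is used up or `i` has no commands left: move on to the next TSG that has
  commands. The overhead `theta` is an upper bound (a runlist update may cut a switch short). -/
  | switch (s : State Task) (i j : Task) (t post : List Task) (d : ℝ)
      (hl : s.runlist = i :: t ++ j :: post) (hi : s.used = S.slice ∨ s.backlog i = 0)
      (ht : ∀ k ∈ t, s.backlog k = 0) (hj : 0 < s.backlog j) (h0 : 0 ≤ d) (h1 : d ≤ S.theta) :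
      Step S drv s (.switch i j) d { s with runlist := j :: post ++ i :: t, used := 0 }
  | renew (s : State Task) (i : Task) (t : List Task) (hl : s.runlist = i :: t)
      (hu : s.used = S.slice) (ht : ∀ k ∈ t, s.backlog k = 0) :
      Step S drv s .renew 0 { s with used := 0 }
  | idle (s : State Task) (d : ℝ) (hb : ∀ k ∈ s.runlist, s.backlog k = 0) (h0 : 0 ≤ d) :
      Step S drv s .idle d s

/-- Initially there are no jobs, and the GPU is idle. -/
def initState : State Task where
  drv := ⟨∅, ∅⟩
  runlist := []
  used := 0
  phase := fun _ => .noJob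
  budget := fun _ => 0
  backlog := fun _ => 0

/-- One entry of an execution trace: the state before the step, the activity, its duration. -/
structure Entry (Task : Type*) where
  pre : State Task
  act : Activity Task
  dur : ℝ

/-- `Run S drv tr s`: the trace `tr` is a finite execution from the initial state to `s`. -/
inductive Run (S : System Task) (drv : Driver Task) : List (Entry Task) → State Task → Prop
  | nil : Run S drv [] initState
  | snoc (tr : List (Entry Task)) (s s' : State Task) (a : Activity Task) (d : ℝ)
      (h : Run S drv tr s) (hs : Step S drv s a d s') : Run S drv (tr ++ [⟨s, a, d⟩]) s'

/-- The time that `i` loses to interleaved execution in one step: the TSG of `i` is on the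
runlist and has commands to execute, but the GPU executes another TSG of the runlist, or switches
from one TSG of the runlist to another. (Time in which `i` is not on the runlist is preemption,
and time spent in runlist updates is accounted for by `epsilon`.) -/
noncomputable def Entry.ieDelay (i : Task) (e : Entry Task) : ℝ :=
  open Classical in
  if i ∈ e.pre.runlist ∧ 0 < e.pre.backlog i then
    match e.act with
    | .exec j => if j = i then 0 else e.dur
    | .switch _ _ => e.dur
    | _ => 0
  else 0

/-- A part of a trace that starts with a job of `i` and does not reach the next job of `i`. -/
def IsJobWindow (i : Task) : List (Entry Task) → Prop
  | [] => False
  | e :: w => e.act = .jobStart i ∧ ∀ e' ∈ w, e'.act ≠ .jobStart i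

/-- The worst-case interference `I^ie_i` from interleaved execution for a task under a driver
policy: the supremum, over all executions and all jobs of the task in them, of the total time
the job loses to interleaved execution. -/
noncomputable def interleavedInterference (S : System Task) (drv : Driver Task) (i : Task) :
    ENNReal :=
  ⨆ (tr : List (Entry Task)) (s : State Task) (_ : Run S drv tr s) (w : List (Entry Task))
    (_ : w <:+: tr) (_ : IsJobWindow i w), ENNReal.ofReal (w.map (Entry.ieDelay i)).sum

end Semantics

end GCAPS

namespace GCAPS

/-! Everything follows from an invariant of reachable states. The driver lists are `Consistent`,
every listed task is inside a GPU segment, and the runlist enumerates `running`. GCAPS preserves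
consistency (`gcaps.consistent_of_segBegin`, `gcaps.consistent_of_segEnd`) because `running` is
either one real-time task or a set of best-effort tasks, all of GPU priority `0`. In both cases an
arriving real-time task that preempts displaces the whole set. Hence a real-time task on the runlist
is its only entry: no other TSG can execute and no switch is possible, so each single step has delay
`0`. -/

theorem System.highest_eq_self_of_forall_not_isRealTime {Task : Type*} (S : System Task)
    {A : Finset Task} (hA : ∀ h ∈ A, ¬ S.IsRealTime h) : S.highest A = A := by
  refine Finset.filter_true_of_mem fun h _ h' hh' => ?_
  have h0 : ¬ 0 < S.gpuPrio h' := fun hpos => hA h' hh' ((S.gpuPrio_pos_iff h').1 hpos)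
  omega

theorem System.highest_singleton {Task : Type*} (S : System Task) (h : Task) :
    S.highest {h} = {h} := by
  simp [System.highest]

/-- The consistency of the driver lists that GCAPS maintains: a running real-time task runs
alone, real-time tasks are pending only while a real-time task is running, and no task is both
running and pending. -/
structure DriverState.Consistent {Task : Type*} (S : System Task) (d : DriverState Task) :
    Prop where
  eq_singleton : ∀ h ∈ d.running, S.IsRealTime h → d.running = {h}
  pending : (∀ h ∈ d.running, ¬ S.IsRealTime h) → ∀ h ∈ d.pending, ¬ S.IsRealTime h
  disjoint : ∀ h ∈ d.running, h ∉ d.pending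

/-- The state invariant under GCAPS: the driver lists are consistent and hold only tasks inside
a GPU segment, and the hardware runlist is one of the running tasks. -/
structure State.Invariant {Task : Type*} (S : System Task) (s : State Task) : Prop where
  consistent : s.drv.Consistent S
  phase : ∀ k, k ∈ s.drv.running ∨ k ∈ s.drv.pending → ∃ j, s.phase k = .gpu j
  runlist : IsRunlistOf s.runlist s.drv

theorem State.Invariant.runlist_eq_singleton {Task : Type*} {S : System Task} {s : State Task}
    (hs : s.Invariant S) {i : Task} (hi : S.IsRealTime i) (hmem : i ∈ s.runlist) :
    s.runlist = [i] := by
  have hrun := hs.consistent.eq_singleton i ((hs.runlist.2 i).1 hmem) hi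
  refine List.perm_singleton.1 ((List.perm_ext_iff_of_nodup hs.runlist.1 (by simp)).2 fun k => ?_)
  rw [hs.runlist.2 k, hrun]
  simp

section

variable {Task : Type*} [DecidableEq Task] {S : System Task}

theorem gcaps.mem_of_segBegin {d d' : DriverState Task} {i k : Task}
    (h : gcaps S d (.segBegin i) d') (hk : k ∈ d'.running ∨ k ∈ d'.pending) :
    k = i ∨ k ∈ d.running ∨ k ∈ d.pending := by
  have hsub : ∀ A : Finset Task, S.highest A ⊆ A := fun A => Finset.filter_subset _ A
  cases h with
  | addBestEffortRunning => simp at hk; tauto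
  | addBestEffortPending => simp at hk; tauto
  | addRealTimeRunning =>
    have := @hsub d.running k
    simp at hk; tauto
  | addRealTimePending => simp at hk; tauto

/-- Disjointness of the new lists is why the beginning task must be on neither old list. -/
theorem gcaps.consistent_of_segBegin {d d' : DriverState Task} {i : Task}
    (h : gcaps S d (.segBegin i) d') (hc : d.Consistent S)
    (hr : i ∉ d.running) (hp : i ∉ d.pending) : d'.Consistent S := by
  obtain ⟨h1, h2, h3⟩ := hc
  cases h with
  | addBestEffortRunning _ _ hi hb =>
    have hall : ∀ k ∈ insert i d.running, ¬ S.IsRealTime k := by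
      simpa [hi] using hb
    refine ⟨fun k hk hrt => absurd hrt (hall k hk), fun _ => h2 hb, fun k hk => ?_⟩
    rcases Finset.mem_insert.1 hk with rfl | hk
    exacts [hp, h3 k hk]
  | addBestEffortPending _ _ hi hb =>
    obtain ⟨k, hk, hrt⟩ := hb
    refine ⟨h1, fun hn => absurd hrt (hn k hk), fun m hm hm' => ?_⟩
    rcases Finset.mem_insert.1 hm' with rfl | hm'
    exacts [hr hm, h3 m hm hm']
  | addRealTimeRunning _ _ hi hb =>
    -- Preemption removes only the tasks of highest priority. These are all the running tasks,
    -- whether best-effort (equal priority `0`) or a single real-time task.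
    have hhigh : S.highest d.running = d.running := by
      by_cases hn : ∀ k ∈ d.running, ¬ S.IsRealTime k
      · exact S.highest_eq_self_of_forall_not_isRealTime hn
      · push Not at hn
        obtain ⟨k, hk, hrt⟩ := hn
        rw [h1 k hk hrt, S.highest_singleton]
    rw [hhigh, Finset.sdiff_self]
    refine ⟨fun k hk _ => ?_, fun hn => absurd hi (hn i (by simp)), fun k hk => ?_⟩
    · simp at hk; simp [hk]
    · simp at hk; simp [hk, hr, hp]
  | addRealTimePending _ _ hi hb =>
    obtain ⟨k, hk, hle⟩ := hb
    -- A task whose priority is at least that of a real-time task has positive priority, so the new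
    -- pending task waits behind a real-time one.
    have hrt : S.IsRealTime k :=
      (S.gpuPrio_pos_iff k).1 (((S.gpuPrio_pos_iff i).2 hi).trans_le hle)
    refine ⟨h1, fun hn => absurd hrt (hn k (Finset.mem_filter.1 hk).1), fun m hm hm' => ?_⟩
    rcases Finset.mem_insert.1 hm' with rfl | hm'
    exacts [hr hm, h3 m hm hm']

/-- The ended task is erased from `running` only; if it were also pending, it could stay listed
after leaving its GPU segment. -/
theorem gcaps.mem_of_segEnd {d d' : DriverState Task} {i k : Task}
    (h : gcaps S d (.segEnd i) d') (hi : i ∉ d.pending)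
    (hk : k ∈ d'.running ∨ k ∈ d'.pending) :
    k ≠ i ∧ (k ∈ d.running ∨ k ∈ d.pending) := by
  have hne : k ∈ d.pending → k ≠ i := by rintro hk rfl; exact hi hk
  cases h with
  | removeNextRealTime _ _ m hm =>
    have hm' : m ∈ d.pending := (Finset.mem_filter.1 (Finset.mem_filter.1 hm).1).1
    simp only [Finset.mem_erase, Finset.mem_insert] at hk
    rcases hk with ⟨hki, rfl | hk⟩ | ⟨-, hk⟩
    exacts [⟨hki, .inr hm'⟩, ⟨hki, .inl hk⟩, ⟨hne hk, .inr hk⟩]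
  | removeNoRealTime => simp at hk; tauto

theorem gcaps.consistent_of_segEnd {d d' : DriverState Task} {i : Task}
    (h : gcaps S d (.segEnd i) d') (hc : d.Consistent S) (hr : i ∈ d.running) :
    d'.Consistent S := by
  obtain ⟨h1, h2, h3⟩ := hc
  -- A real-time task runs alone, so one left beside `i` would be `i` itself.
  have hrest : ∀ k ∈ d.running.erase i, ¬ S.IsRealTime k := by
    intro k hk hrt
    obtain ⟨hki, hk⟩ := Finset.mem_erase.1 hk
    rw [h1 k hk hrt, Finset.mem_singleton] at hr
    exact hki hr.symm
  cases h with
  | removeNextRealTime _ _ k hk =>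
    obtain ⟨hkp, hk'⟩ := Finset.mem_filter.1 (Finset.mem_filter.1 hk).1
    -- A pending real-time task needs a running real-time one. If `i` were best-effort, all running
    -- tasks would be, and `k` could not be pending.
    have hrun : d.running = {i} := by
      by_cases hi : S.IsRealTime i
      · exact h1 i hr hi
      · refine absurd hk' (h2 (fun m hm => ?_) k hkp)
        by_cases hmi : m = i
        · rwa [hmi]
        · exact hrest m (Finset.mem_erase.2 ⟨hmi, hm⟩)
    -- Disjointness ensures that erasing `i` does not remove the newly promoted `k`.
    have hki : k ≠ i := by rintro rfl; exact h3 k hr hkp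
    have hnew : (insert k d.running).erase i = {k} := by
      rw [hrun]; ext m; simp; grind
    rw [hnew]
    refine ⟨fun m hm _ => ?_, fun hn => absurd hk' (hn k (by simp)), fun m hm => ?_⟩
    · simp at hm; simp [hm]
    · simp at hm; simp [hm]
  | removeNoRealTime _ _ hp =>
    refine ⟨fun k hk hrt => ?_, by simp, by simp⟩
    rcases Finset.mem_union.1 hk with hk | hk
    exacts [absurd hrt (hrest k hk), absurd hrt (hp k hk)]

/-- The phases link task behaviour to the lists: a task outside a GPU segment is on neither list, so
job starts and ends do not affect listed tasks, and a segment always begins with an unlisted task.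
-/
theorem Step.invariant {s s' : State Task} {a : Activity Task} {d : ℝ}
    (h : Step S (gcaps S) s a d s') (hs : s.Invariant S) : s'.Invariant S := by
  obtain ⟨hc, hph, hl⟩ := hs
  cases h with
  | jobStart i hp =>
    refine ⟨hc, fun k hk => ?_, hl⟩
    obtain ⟨j, hj⟩ := hph k hk
    have hki : k ≠ i := by rintro rfl; simp [hp] at hj
    exact ⟨j, by simpa [hki] using hj⟩
  | jobEnd i hp =>
    refine ⟨hc, fun k hk => ?_, hl⟩
    obtain ⟨j, hj⟩ := hph k hk
    have hki : k ≠ i := by rintro rfl; simp [hp] at hj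
    exact ⟨j, by simpa [hki] using hj⟩
  | segBegin i j d' l _ hp hd hl' =>
    have hnot : ¬ (i ∈ s.drv.running ∨ i ∈ s.drv.pending) := by
      intro hi
      obtain ⟨m, hm⟩ := hph i hi
      simp [hp] at hm
    rw [not_or] at hnot
    refine ⟨hd.consistent_of_segBegin hc hnot.1 hnot.2, fun k hk => ?_, hl'⟩
    by_cases hki : k = i
    · exact ⟨j, by simp [hki]⟩
    · obtain ⟨m, hm⟩ := hph k ((hd.mem_of_segBegin hk).resolve_left hki)
      exact ⟨m, by simpa [hki] using hm⟩
  | segEnd i j d' l _ hp hb hr hd hl' =>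
    refine ⟨hd.consistent_of_segEnd hc hr, fun k hk => ?_, hl'⟩
    obtain ⟨hki, hk⟩ := hd.mem_of_segEnd (hc.disjoint i hr) hk
    obtain ⟨m, hm⟩ := hph k hk
    exact ⟨m, by simpa [hki] using hm⟩
  | switch i j t post _ hl' =>
    -- A switch only rotates the runlist.
    have hperm : (j :: post ++ i :: t).Perm s.runlist := by
      rw [hl']; exact List.perm_append_comm
    exact ⟨hc, hph, hperm.nodup_iff.2 hl.1, fun k => hperm.mem_iff.trans (hl.2 k)⟩
  | submit => exact ⟨hc, hph, hl⟩
  | exec => exact ⟨hc, hph, hl⟩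
  | renew => exact ⟨hc, hph, hl⟩
  | idle => exact ⟨hc, hph, hl⟩

theorem Run.invariant {tr : List (Entry Task)} {s : State Task}
    (h : Run S (gcaps S) tr s) : s.Invariant S := by
  induction h with
  | nil => exact ⟨⟨by simp [initState], by simp [initState], by simp [initState]⟩,
      by simp [initState], by simp [IsRunlistOf, initState]⟩
  | snoc tr s s' a d _ hs ih => exact hs.invariant ih

/-- Holds under any driver policy: only the head of the runlist executes, and a switch needs two
entries. -/
theorem Step.ieDelay_eq_zero {drv : Driver Task} {s s' : State Task} {a : Activity Task} {d : ℝ}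
    (h : Step S drv s a d s') {i : Task} (hi : i ∈ s.runlist → s.runlist = [i]) :
    Entry.ieDelay i ⟨s, a, d⟩ = 0 := by
  unfold Entry.ieDelay
  split_ifs with hc
  · have hs := hi hc.1
    cases h with
    | exec j t _ hl =>
      rw [hs] at hl
      simp_all
    | switch j k t post _ hl =>
      rw [hs] at hl
      simp at hl
    | _ => rfl
  · rfl

theorem Run.ieDelay_eq_zero {tr : List (Entry Task)} {s : State Task}
    (h : Run S (gcaps S) tr s) {i : Task} (hi : S.IsRealTime i) :
    ∀ e ∈ tr, e.ieDelay i = 0 := by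
  induction h with
  | nil => simp
  | snoc tr s s' a d hrun hs ih =>
    intro e he
    rcases List.mem_append.1 he with he | he
    · exact ih e he
    · rw [List.mem_singleton.1 he]
      exact hs.ieDelay_eq_zero (hrun.invariant.runlist_eq_singleton hi)

end

end GCAPS

theorem lemma9 {Task : Type*} [DecidableEq Task] (S : GCAPS.System Task)
    (i : Task) (hi : S.IsRealTime i) :
    (∀ (tr : List (GCAPS.Entry Task)) (s : GCAPS.State Task),
        GCAPS.Run S (GCAPS.gcaps S) tr s → i ∈ s.runlist → s.runlist = [i]) ∧
      GCAPS.interleavedInterference S (GCAPS.gcaps S) i = 0 := by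
  refine ⟨fun tr s h => h.invariant.runlist_eq_singleton hi, ?_⟩
  simp only [GCAPS.interleavedInterference, ENNReal.iSup_eq_zero, ENNReal.ofReal_eq_zero]
  intro tr s h w hw _
  -- The delay vanishes entry by entry along the whole trace, hence on each window of it.
  refine (List.sum_eq_zero fun x hx => ?_).le
  obtain ⟨e, he, rfl⟩ := List.mem_map.1 hx
  exact h.ieDelay_eq_zero hi e (hw.subset he)
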